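/- Let ${}_1F_2(a;b,c;x)=\sum_{n\ge 0}\frac{(a)_n}{(b)_n(c)_n}\frac{x^n}{n!}$, where $(a)_n=a(a+1)\cdots(a+n-1)$. For real $\mu,\nu$ such that neither $\mu+\nu$ nor $\mu-\nu$ is an odd negative integer, and for $z>0$, let $$s_{\mu,\nu}(z)=\frac{z^{\mu+1}}{(\mu-\nu+1)(\mu+\nu+1)}\,{}_1F_2\Bigl(1;\tfrac{\mu-\nu+3}{2},\tfrac{\mu+\nu+3}{2};-\tfrac{z^2}{4}\Bigr)$$ be the Lommel function of the first kind. Consider the Turán type inequality $$(\mathrm{T}_\mu)\qquad \bigl[s_{\mu,\frac12}(z)\bigr]^2-s_{\mu-1,\frac12}(z)\,s_{\mu+1,\frac12}(z)>\frac{1}{\frac12-\mu}\bigl[s_{\mu,\frac12}(z)\bigr]^2 ,$$ and say that $(\mathrm{T}_\mu)$ is reversed at $z$ if it holds there with $<$ in place of $>$. For real $\mu$ let $$\varphi_0(z)={}_1F_2\Bigl(1;\tfrac{\mu+2}{2},\tfrac{\mu+3}{2};-\tfrac{z^2}{4}\Bigr),$$ let $\xi_{\mu,1}$ be the first positive zero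 of this function $\varphi_0$ with parameter $\mu$, and let $\sigma_{\mu}$ be the first positive zero of $s_{\mu,\frac12}$. (Since $\sqrt z\,s_{\mu-\frac12,\frac12}(z)=\frac{z^{\mu+1}}{\mu(\mu+1)}\varphi_0(z)$, one has $\sigma_\mu=\xi_{\mu+\frac12,1}$ whenever $s_{\mu,\frac12}$ is defined.) 1. Let $\mu\in\left(-\frac12,\frac12\right)$. Then the first positive zeros $\xi_{\mu-1,1}$ and $\sigma_{\mu-1}$ exist, and $(\mathrm{T}_\mu)$ is reversed for all $z\in(0,\xi_{\mu-1,1})$ and also for all $z\in(0,\sigma_{\mu-1})$. 2. Let $m\ge 2$ be an integer and $m-\frac32<\mu<m-\frac12$. Then the first positive zeros $\xi_{\mu-m,1}$ and $\sigma_{\mu-m}$ exist, and $(\mathrm{T}_\mu)$ holds for all $z\in(0,\xi_{\mu-m,1})$ and also for all $z\in(0,\sigma_{\mu-m})$. -/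

import Mathlib

noncomputable section

/-- The generalized hypergeometric function `₁F₂(a; b, c; x)` of real arguments: the sum over `n`
of `(a)ₙ / ((b)ₙ (c)ₙ) * xⁿ / n!`, where `(a)ₙ = a (a + 1) ⋯ (a + n - 1)` is the Pochhammer symbol.
The lower parameters `b`, `c` are meant not to be in `{0, -1, -2, …}`; the series then converges
absolutely for every real `x`. -/
def hypergeometricOneFTwo (a b c x : ℝ) : ℝ :=
  ∑' n : ℕ, (ascPochhammer ℝ n).eval a /
    ((ascPochhammer ℝ n).eval b * (ascPochhammer ℝ n).eval c) * (x ^ n / (n.factorial : ℝ))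

/-- The Lommel function of the first kind `s_{μ,ν}(z)` for real `μ`, `ν` and `z > 0`. It is meant
for `μ + ν` and `μ - ν` not odd negative integers. -/
def lommelS (μ ν z : ℝ) : ℝ :=
  z ^ (μ + 1) / ((μ - ν + 1) * (μ + ν + 1)) *
    hypergeometricOneFTwo 1 ((μ - ν + 3) / 2) ((μ + ν + 3) / 2) (-z ^ 2 / 4)

/-- The function `φ_k(z) = ₁F₂(1; (μ - k + 2)/2, (μ - k + 3)/2; -z²/4)`, with its dependence on the
real parameter `μ` made explicit. -/
def lommelPhi (μ : ℝ) (k : ℕ) (z : ℝ) : ℝ :=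
  hypergeometricOneFTwo 1 ((μ - k + 2) / 2) ((μ - k + 3) / 2) (-z ^ 2 / 4)

/-- The set of positive zeros of a real function. -/
def positiveZeros (f : ℝ → ℝ) : Set ℝ := {z | 0 < z ∧ f z = 0}

/-- `ξ_{μ,1}`: the first positive zero of `φ_0` (with parameter `μ`). The theorem asserts that the
infimum is attained wherever it is used. -/
def phiFirstZero (μ : ℝ) : ℝ := sInf (positiveZeros (lommelPhi μ 0))

/-- The first positive zero of the Lommel function `s_{μ,1/2}`. The theorem asserts that the
infimum is attained wherever it is used. -/
def lommelFirstZero (μ : ℝ) : ℝ := sInf (positiveZeros (lommelS μ (1 / 2)))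

/-- The Turán type inequality
`s_{μ,1/2}(z)² - s_{μ-1,1/2}(z) s_{μ+1,1/2}(z) > (1/2 - μ)⁻¹ s_{μ,1/2}(z)²`. -/
def TuranIneq (μ z : ℝ) : Prop :=
  (lommelS μ (1 / 2) z) ^ 2 - lommelS (μ - 1) (1 / 2) z * lommelS (μ + 1) (1 / 2) z >
    1 / (1 / 2 - μ) * (lommelS μ (1 / 2) z) ^ 2

/-- The same inequality with the opposite (strict) sign. -/
def TuranIneqReversed (μ z : ℝ) : Prop :=
  (lommelS μ (1 / 2) z) ^ 2 - lommelS (μ - 1) (1 / 2) z * lommelS (μ + 1) (1 / 2) z <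
    1 / (1 / 2 - μ) * (lommelS μ (1 / 2) z) ^ 2

end

open Set Filter Topology intervalIntegral

/-! Write `A_c(z) = ∑ (-1)ⁿ z²ⁿ / (c)₂ₙ`. At `ν = 1/2` every function involved is a power of `z`
times some `A_c`, and with `a = μ + 1/2 > 0` the two sides of the Turán inequality differ by a
positive factor times `((a+2) A_{a+2}² - (a+1) A_{a+1} A_{a+3}) / (μ - 1/2)`. If the numerator is
positive, the sign of `μ - 1/2` alone decides between the inequality and its reverse.

Positivity holds on all of `(0, π]` (`alternatingPochhammer_mul_lt_sq`): up to a positive factor the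
numerator is `W = G'² - G G''` for `G(z) = ∫₀ᶻ sin(z - t) tᵃ dt`; `W(0) = 0`, and `W'` has the sign
of an integral against `sin (z u)`, `0 < u < 1`. It remains to see that the zeros bounding the
intervals exist and are at most `π` (`isLeast_positiveZeros_alternatingPochhammer`); they are zeros
of `A_c` with `1/2 < c < 2`. -/

theorem ascPochhammer_eval_succ_left (k : ℕ) (c : ℝ) :
    (ascPochhammer ℝ (k + 1)).eval c = c * (ascPochhammer ℝ k).eval (c + 1) := by
  simp [ascPochhammer_succ_left]

theorem factorial_le_ascPochhammer_eval {c : ℝ} (hc : 1 ≤ c) (k : ℕ) :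
    (k.factorial : ℝ) ≤ (ascPochhammer ℝ k).eval c := by
  induction k with
  | zero => simp
  | succ k ih =>
    rw [ascPochhammer_succ_eval, Nat.factorial_succ, mul_comm]
    push_cast
    have : (0 : ℝ) ≤ k := Nat.cast_nonneg k
    have h0 : (0 : ℝ) ≤ k.factorial := Nat.cast_nonneg _
    exact mul_le_mul ih (by linarith) (by linarith) (h0.trans ih)

/-- Duplication formula for the Pochhammer symbol. -/
theorem ascPochhammer_eval_two_mul (c : ℝ) (n : ℕ) :
    (ascPochhammer ℝ n).eval (c / 2) * (ascPochhammer ℝ n).eval ((c + 1) / 2) * 4 ^ n =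
      (ascPochhammer ℝ (2 * n)).eval c := by
  induction n with
  | zero => simp
  | succ n ih =>
    rw [show 2 * (n + 1) = 2 * n + 1 + 1 by ring]
    simp only [ascPochhammer_succ_eval, ← ih]
    push_cast
    ring

/-- The series `∑ (-1)ⁿ z²ⁿ / (c)₂ₙ`. -/
noncomputable def alternatingPochhammer (c z : ℝ) : ℝ :=
  ∑' n : ℕ, (-1) ^ n * z ^ (2 * n) / (ascPochhammer ℝ (2 * n)).eval c

theorem hypergeometricOneFTwo_eq_alternatingPochhammer (c z : ℝ) :
    hypergeometricOneFTwo 1 (c / 2) ((c + 1) / 2) (-z ^ 2 / 4) = alternatingPochhammer c z := by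
  unfold hypergeometricOneFTwo alternatingPochhammer
  congr 1
  ext n
  have h : (n.factorial : ℝ) ≠ 0 := by positivity
  rw [← ascPochhammer_eval_two_mul, ascPochhammer_eval_one, div_pow, neg_pow, ← pow_mul]
  field_simp

/-! ### Beta integrals and trigonometric integral representations. -/

theorem intervalIntegrable_one_sub_rpow {b : ℝ} (hb : 0 < b) :
    IntervalIntegrable (fun u : ℝ => (1 - u) ^ (b - 1)) MeasureTheory.volume 0 1 := by
  simpa using ((intervalIntegrable_rpow' (a := 0) (b := 1) (r := b - 1)
    (by linarith)).comp_sub_left 1).symm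

theorem integral_one_sub_rpow {b : ℝ} (hb : 0 < b) :
    ∫ u in (0 : ℝ)..1, (1 - u) ^ (b - 1) = 1 / b := by
  rw [integral_comp_sub_left (fun u : ℝ => u ^ (b - 1)), integral_rpow (Or.inl (by linarith))]
  simp [hb.ne']

/-- The beta integral with one natural parameter. -/
theorem integral_pow_mul_one_sub_rpow {b : ℝ} (hb : 0 < b) (k : ℕ) :
    ∫ u in (0 : ℝ)..1, u ^ k * (1 - u) ^ (b - 1) =
      k.factorial / (ascPochhammer ℝ (k + 1)).eval b := by
  induction k generalizing b with
  | zero => simpa using integral_one_sub_rpow hb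
  | succ k ih =>
    have hint : ∀ {b : ℝ}, 0 < b → IntervalIntegrable (fun u : ℝ => u ^ k * (1 - u) ^ (b - 1))
        MeasureTheory.volume 0 1 := fun hb =>
      (intervalIntegrable_one_sub_rpow hb).continuousOn_mul (by fun_prop)
    have h1 : ∫ u in (0 : ℝ)..1, u ^ (k + 1) * (1 - u) ^ (b - 1) =
        ∫ u in (0 : ℝ)..1, (u ^ k * (1 - u) ^ (b - 1) - u ^ k * (1 - u) ^ (b + 1 - 1)) := by
      refine integral_congr fun u hu => ?_
      rw [uIcc_of_le zero_le_one] at hu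
      have : (1 - u) ^ (b + 1 - 1) = (1 - u) ^ (b - 1) * (1 - u) := by
        rcases eq_or_lt_of_le hu.2 with h | h
        · simp [h, hb.ne']
        · rw [show b + 1 - 1 = b - 1 + 1 by ring, Real.rpow_add_one (by linarith)]
      simp only [this]
      ring
    have hb1 : 0 < b + 1 := by linarith
    rw [h1, integral_sub (hint hb) (hint hb1), ih hb, ih hb1, ascPochhammer_eval_succ_left (k + 1),
      ascPochhammer_eval_succ_left k b, ascPochhammer_succ_eval, Nat.factorial_succ]
    have := (ascPochhammer_pos k _ hb1).ne'
    have : b + 1 + k ≠ 0 := by positivity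
    push_cast
    field_simp
    ring

/-- Termwise integration of a power series against `(1 - u) ^ (b - 1)`. -/
theorem hasSum_integral_mul_one_sub_rpow {b : ℝ} (hb : 0 < b) {α : ℕ → ℝ} (k : ℕ → ℕ) {F : ℝ → ℝ}
    (hα : Summable fun n => |α n|) (hF : ∀ u, HasSum (fun n => α n * u ^ k n) (F u)) :
    HasSum (fun n => α n * ((k n).factorial / (ascPochhammer ℝ (k n + 1)).eval b))
      (∫ u in (0 : ℝ)..1, F u * (1 - u) ^ (b - 1)) := by
  have key := hasSum_integral_of_dominated_convergence (a := 0) (b := 1)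
    (μ := MeasureTheory.volume) (F := fun n u => α n * (u ^ k n * (1 - u) ^ (b - 1)))
    (f := fun u => F u * (1 - u) ^ (b - 1)) (fun n u => |α n| * (1 - u) ^ (b - 1))
    (fun n => ?_) (fun n => ?_) (.of_forall fun u _ => hα.mul_right _) ?_
    (.of_forall fun u _ => ?_)
  · simpa only [integral_const_mul, integral_pow_mul_one_sub_rpow hb] using key
  · exact Measurable.aestronglyMeasurable (by fun_prop)
  · refine .of_forall fun u hu => ?_
    rw [uIoc_of_le zero_le_one] at hu
    have h1 : 0 ≤ (1 - u) ^ (b - 1) := Real.rpow_nonneg (by linarith [hu.2]) _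
    rw [Real.norm_eq_abs, abs_mul, abs_mul, abs_of_nonneg h1, abs_of_nonneg (pow_nonneg hu.1.le _)]
    have := mul_le_mul_of_nonneg_right (pow_le_one₀ (n := k n) hu.1.le hu.2) h1
    exact mul_le_mul_of_nonneg_left (by linarith) (abs_nonneg _)
  · simp only [tsum_mul_right]
    exact (intervalIntegrable_one_sub_rpow hb).const_mul _
  · simpa only [mul_assoc] using (hF u).mul_right ((1 - u) ^ (b - 1))

theorem integral_cos_mul_one_sub_rpow {b : ℝ} (hb : 0 < b) (z : ℝ) :
    ∫ u in (0 : ℝ)..1, Real.cos (z * u) * (1 - u) ^ (b - 1) =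
      alternatingPochhammer (b + 1) z / b := by
  have h := hasSum_integral_mul_one_sub_rpow hb
    (α := fun n => (-1) ^ n * z ^ (2 * n) / (2 * n).factorial) (fun n => 2 * n)
    (F := fun u => Real.cos (z * u)) (Real.hasSum_cos z).summable.abs (fun u => by
      simpa only [mul_pow, div_mul_eq_mul_div, mul_assoc] using Real.hasSum_cos (z * u))
  rw [← h.tsum_eq, alternatingPochhammer, ← tsum_div_const]
  congr 1
  ext n
  have : ((2 * n).factorial : ℝ) ≠ 0 := by positivity
  rw [ascPochhammer_eval_succ_left]
  field_simp

theorem integral_sin_mul_one_sub_rpow {b : ℝ} (hb : 0 < b) (z : ℝ) :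
    ∫ u in (0 : ℝ)..1, Real.sin (z * u) * (1 - u) ^ (b - 1) =
      z * alternatingPochhammer (b + 2) z / (b * (b + 1)) := by
  have h := hasSum_integral_mul_one_sub_rpow hb
    (α := fun n => (-1) ^ n * z ^ (2 * n + 1) / (2 * n + 1).factorial) (fun n => 2 * n + 1)
    (F := fun u => Real.sin (z * u)) (Real.hasSum_sin z).summable.abs (fun u => by
      simpa only [mul_pow, div_mul_eq_mul_div, mul_assoc] using Real.hasSum_sin (z * u))
  rw [← h.tsum_eq, alternatingPochhammer, ← tsum_mul_left, ← tsum_div_const]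
  congr 1
  ext n
  have : ((2 * n + 1).factorial : ℝ) ≠ 0 := by positivity
  rw [ascPochhammer_eval_succ_left, ascPochhammer_eval_succ_left,
    show b + 1 + 1 = b + 2 by ring, pow_succ]
  field_simp

/-! ### Derivative, recurrence and continuity of the series. -/

/-- The termwise derivative of the series, together with the resulting recurrence. -/
theorem exists_hasDerivAt_alternatingPochhammer {c : ℝ} (hc : 0 < c) (z : ℝ) :
    ∃ D, HasDerivAt (alternatingPochhammer (c + 1)) D z ∧
      HasSum (fun n : ℕ => (-1) ^ n * z ^ (2 * n) / (ascPochhammer ℝ (2 * n)).eval c)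
        (alternatingPochhammer (c + 1) z + z * D / c) := by
  have hc1 : 1 ≤ c + 1 := by linarith
  have hP : ∀ k, 0 < (ascPochhammer ℝ k).eval (c + 1) := fun k => ascPochhammer_pos k _ (by linarith)
  set R := |z| + 1 with hR
  have hR0 : 0 < R := by positivity
  have hs : ∀ x : ℝ, Summable fun n : ℕ =>
      (-1) ^ n * x ^ (2 * n) / (ascPochhammer ℝ (2 * n)).eval (c + 1) := by
    intro x
    refine Summable.of_norm_bounded ((Real.hasSum_cos x).summable.abs) fun n => ?_
    rw [Real.norm_eq_abs, abs_div, abs_div, Nat.abs_cast, abs_of_pos (hP _)]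
    gcongr
    exact factorial_le_ascPochhammer_eval hc1 _
  have hu : Summable fun n : ℕ => R ^ (2 * n - 1) / ((2 * n - 1).factorial : ℝ) := by
    rw [← summable_nat_add_iff 1]
    refine (Real.hasSum_sin R).summable.abs.congr fun n => ?_
    rw [abs_div, Nat.abs_cast, abs_mul, abs_pow, abs_neg, abs_one, one_pow, one_mul,
      abs_of_pos (pow_pos hR0 _), show 2 * (n + 1) - 1 = 2 * n + 1 by omega]
  set g' : ℕ → ℝ → ℝ := fun n x => (-1) ^ n * (((2 * n : ℕ) : ℝ) * x ^ (2 * n - 1)) /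
    (ascPochhammer ℝ (2 * n)).eval (c + 1) with hg'
  have hbound : ∀ n, ∀ x ∈ Metric.ball (0 : ℝ) R,
      ‖g' n x‖ ≤ R ^ (2 * n - 1) / ((2 * n - 1).factorial : ℝ) := by
    intro n x hx
    rw [mem_ball_zero_iff, Real.norm_eq_abs] at hx
    rw [hg', Real.norm_eq_abs, abs_div, abs_of_pos (hP _), abs_mul, abs_pow, abs_neg, abs_one,
      one_pow, one_mul, abs_mul, Nat.abs_cast, abs_pow]
    rcases Nat.eq_zero_or_pos n with rfl | hn
    · simp
    · calc _ ≤ (2 * n : ℕ) * R ^ (2 * n - 1) / ((2 * n).factorial : ℝ) := by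
            gcongr
            exact factorial_le_ascPochhammer_eval hc1 _
        _ = _ := by
            rw [← Nat.mul_factorial_pred (show 2 * n ≠ 0 by omega)]
            have : ((2 * n : ℕ) : ℝ) ≠ 0 := by positivity
            push_cast at this ⊢
            field_simp
  have hz : z ∈ Metric.ball (0 : ℝ) R := by
    rw [mem_ball_zero_iff, Real.norm_eq_abs]; linarith
  have hder := hasDerivAt_tsum_of_isPreconnected hu Metric.isOpen_ball
    (convex_ball (0 : ℝ) R).isPreconnected
    (g := fun n x => (-1) ^ n * x ^ (2 * n) / (ascPochhammer ℝ (2 * n)).eval (c + 1)) (g' := g')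
    (fun n x _ => ((hasDerivAt_pow (2 * n) x).const_mul _).div_const _) hbound
    (Metric.mem_ball_self hR0) (hs 0) hz
  refine ⟨_, hder, ?_⟩
  have hsD : Summable fun n => g' n z := Summable.of_norm_bounded hu fun n => hbound n z hz
  -- Termwise this is `1/(c)₂ₙ = (1 + 2n/c)/(c+1)₂ₙ`; it also yields summability for `0 < c < 1`,
  -- where the factorial bound fails.
  convert (hs z).hasSum.add ((hsD.hasSum.mul_left z).div_const c) using 1
  swap
  · rfl
  ext n
  simp only [hg']
  rcases Nat.eq_zero_or_pos n with rfl | hn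
  · simp
  · obtain ⟨k, rfl⟩ := Nat.exists_eq_add_of_le' hn
    have h1 := ascPochhammer_eval_succ_left (2 * k + 1) c
    have h2 := ascPochhammer_succ_eval (2 * k + 1) (c + 1)
    have h3 : c + 1 + ((2 * k + 1 : ℕ) : ℝ) ≠ 0 := by positivity
    have h4 := (hP (2 * k + 1)).ne'
    rw [show 2 * (k + 1) = 2 * k + 1 + 1 by ring, h1, h2, Nat.add_sub_cancel]
    field_simp
    push_cast
    ring

theorem hasSum_alternatingPochhammer {c : ℝ} (hc : 0 < c) (z : ℝ) :
    HasSum (fun n : ℕ => (-1) ^ n * z ^ (2 * n) / (ascPochhammer ℝ (2 * n)).eval c)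
      (alternatingPochhammer c z) := by
  obtain ⟨D, -, h⟩ := exists_hasDerivAt_alternatingPochhammer hc z
  exact h.summable.hasSum

theorem hasDerivAt_alternatingPochhammer {c : ℝ} (hc : 0 < c) {z : ℝ} (hz : z ≠ 0) :
    HasDerivAt (alternatingPochhammer (c + 1))
      (c * (alternatingPochhammer c z - alternatingPochhammer (c + 1) z) / z) z := by
  obtain ⟨D, hD, h⟩ := exists_hasDerivAt_alternatingPochhammer hc z
  convert hD using 1
  rw [(hasSum_alternatingPochhammer hc z).unique h]
  field_simp
  ring

theorem alternatingPochhammer_eq_one_sub {c : ℝ} (hc : 0 < c) (z : ℝ) :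
    alternatingPochhammer c z =
      1 - z ^ 2 / (c * (c + 1)) * alternatingPochhammer (c + 2) z := by
  rw [alternatingPochhammer, (hasSum_alternatingPochhammer hc z).summable.tsum_eq_zero_add,
    alternatingPochhammer, sub_eq_add_neg, ← neg_mul, ← tsum_mul_left]
  simp only [mul_zero, pow_zero, ascPochhammer_zero, Polynomial.eval_one, mul_one, div_one]
  congr 2
  ext n
  rw [show 2 * (n + 1) = 2 * n + 1 + 1 by ring, ascPochhammer_eval_succ_left,
    ascPochhammer_eval_succ_left, show c + 1 + 1 = c + 2 by ring]
  have := (ascPochhammer_pos (2 * n) (c + 2) (by linarith)).ne'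
  field_simp
  ring

/-- Differentiability is available only for parameters above `1`; the recurrence, which raises `c`
by `2`, covers the rest. -/
theorem continuous_alternatingPochhammer {c : ℝ} (hc : 0 < c) :
    Continuous (alternatingPochhammer c) := by
  have h : Continuous (alternatingPochhammer (c + 2)) := by
    rw [show c + 2 = c + 1 + 1 by ring]
    refine continuous_iff_continuousAt.2 fun z => ?_
    obtain ⟨D, hD, -⟩ := exists_hasDerivAt_alternatingPochhammer (c := c + 1) (by linarith) z
    exact hD.continuousAt
  rw [funext (alternatingPochhammer_eq_one_sub hc)]
  fun_prop

/-! ### The first positive zero is at most `π`. -/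

theorem alternatingPochhammer_le_one {b : ℝ} (hb : 0 < b) (z : ℝ) :
    alternatingPochhammer (b + 1) z ≤ 1 := by
  have hle : ∫ u in (0 : ℝ)..1, Real.cos (z * u) * (1 - u) ^ (b - 1) ≤
      ∫ u in (0 : ℝ)..1, (1 - u) ^ (b - 1) := by
    refine integral_mono_on zero_le_one
      ((intervalIntegrable_one_sub_rpow hb).continuousOn_mul (by fun_prop))
      (intervalIntegrable_one_sub_rpow hb) fun u hu => ?_
    exact mul_le_of_le_one_left (Real.rpow_nonneg (by linarith [hu.2]) _) (Real.cos_le_one _)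
  rw [integral_cos_mul_one_sub_rpow hb, integral_one_sub_rpow hb] at hle
  exact (div_le_div_iff_of_pos_right hb).1 hle

/-- For `c < 2` the weight `(1 - u)^(c-2)` increases, so it favours the half of `[0, 1]` where `cos
(π u)` is negative. Comparison is with the constant `w`, the weight at the sign change `u = 1/2`. -/
theorem alternatingPochhammer_pi_nonpos {c : ℝ} (h1 : 1 < c) (h2 : c < 2) :
    alternatingPochhammer c Real.pi ≤ 0 := by
  have hb : 0 < c - 1 := by linarith
  have hw := intervalIntegrable_one_sub_rpow hb
  have hcos : IntervalIntegrable (fun u => Real.cos (Real.pi * u)) MeasureTheory.volume 0 1 :=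
    Continuous.intervalIntegrable (by fun_prop) _ _
  have hcos0 : ∫ u in (0 : ℝ)..1, Real.cos (Real.pi * u) = 0 := by
    rw [integral_comp_mul_left (fun x => Real.cos x) Real.pi_ne_zero]
    simp
  set w : ℝ := (1 / 2 : ℝ) ^ (c - 1 - 1) with hwdef
  have hle : ∫ u in (0 : ℝ)..1, Real.cos (Real.pi * u) * (1 - u) ^ (c - 1 - 1) ≤
      ∫ u in (0 : ℝ)..1, Real.cos (Real.pi * u) * w := by
    refine integral_mono_on_of_le_Ioo zero_le_one (hw.continuousOn_mul (by fun_prop))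
      (hcos.mul_const _) fun u hu => ?_
    have hpi := Real.pi_pos
    rcases le_total u (1 / 2) with h | h
    · refine mul_le_mul_of_nonneg_left ?_ (Real.cos_nonneg_of_mem_Icc ⟨?_, ?_⟩)
      · exact Real.rpow_le_rpow_of_nonpos (by norm_num) (by linarith) (by linarith)
      · nlinarith [mul_pos hpi hu.1]
      · nlinarith
    · refine mul_le_mul_of_nonpos_left ?_ (Real.cos_nonpos_of_pi_div_two_le_of_le ?_ ?_)
      · exact Real.rpow_le_rpow_of_nonpos (by linarith [hu.2]) (by linarith) (by linarith)
      · nlinarith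
      · nlinarith [hu.2]
  rw [integral_cos_mul_one_sub_rpow hb, integral_mul_const, hcos0, zero_mul, sub_add_cancel] at hle
  by_contra! h
  exact absurd hle (not_le.2 (div_pos h hb))

theorem exists_alternatingPochhammer_nonpos {c : ℝ} (h1 : 1 / 2 < c) (h2 : c < 2) :
    ∃ z, 0 < z ∧ z ≤ Real.pi ∧ alternatingPochhammer c z ≤ 0 := by
  rcases lt_or_ge 1 c with h | h
  · exact ⟨Real.pi, Real.pi_pos, le_rfl, alternatingPochhammer_pi_nonpos h h2⟩
  have hc : 0 < c := by linarith
  have hq : 0 < (c + 2) * (c + 3) / 2 := by positivity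
  -- This choice makes `A_{c+2} = 1 - A_{c+4}/2 ≥ 1/2`, while `z²/(c(c+1)) ≥ 2`, so `A_c ≤ 0`; and
  -- `z² ≤ 6 < π²`.
  refine ⟨√((c + 2) * (c + 3) / 2), Real.sqrt_pos.2 hq, ?_, ?_⟩
  · rw [Real.sqrt_le_left Real.pi_pos.le]
    nlinarith [Real.pi_gt_three]
  · set z := √((c + 2) * (c + 3) / 2) with hz
    have hzz : z ^ 2 = (c + 2) * (c + 3) / 2 := Real.sq_sqrt hq.le
    have h4 := alternatingPochhammer_le_one (b := c + 3) (by linarith) z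
    rw [alternatingPochhammer_eq_one_sub hc, alternatingPochhammer_eq_one_sub (c := c + 2)
      (by linarith), hzz, show c + 2 + 2 = c + 3 + 1 by ring, show c + 2 + 1 = c + 3 by ring]
    have h5 : (c + 2) * (c + 3) / 2 / ((c + 2) * (c + 3)) = 1 / 2 := by field_simp
    have h6 : 2 ≤ (c + 2) * (c + 3) / 2 / (c * (c + 1)) := by
      rw [le_div_iff₀ (by positivity)]
      nlinarith
    rw [h5]
    nlinarith

theorem alternatingPochhammer_zero_right {c : ℝ} (hc : 0 < c) : alternatingPochhammer c 0 = 1 := by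
  rw [alternatingPochhammer_eq_one_sub hc]
  simp

/-- The first positive zero exists and is at most `π`. -/
theorem isLeast_positiveZeros_alternatingPochhammer {c : ℝ} (h1 : 1 / 2 < c) (h2 : c < 2) :
    IsLeast (positiveZeros (alternatingPochhammer c))
      (sInf (positiveZeros (alternatingPochhammer c))) ∧
    sInf (positiveZeros (alternatingPochhammer c)) ≤ Real.pi := by
  have hc : 0 < c := by linarith
  have hcont := continuous_alternatingPochhammer hc
  have h0 := alternatingPochhammer_zero_right hc
  obtain ⟨z, hz0, hzpi, hz⟩ := exists_alternatingPochhammer_nonpos h1 h2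
  -- Since `A_c(0) = 1`, admitting `0` adds no zero, and the set becomes visibly closed.
  have heq : positiveZeros (alternatingPochhammer c) =
      Ici 0 ∩ alternatingPochhammer c ⁻¹' {0} := by
    ext x
    simp only [positiveZeros, mem_ofPred_eq, mem_inter_iff, mem_Ici, mem_preimage,
      mem_singleton_iff]
    refine and_congr_left fun hx => ⟨le_of_lt, fun h => lt_of_le_of_ne h ?_⟩
    rintro rfl
    simp [h0] at hx
  have hclosed : IsClosed (positiveZeros (alternatingPochhammer c)) := by
    rw [heq]
    exact isClosed_Ici.inter (isClosed_singleton.preimage hcont)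
  have hbdd : BddBelow (positiveZeros (alternatingPochhammer c)) := ⟨0, fun x hx => hx.1.le⟩
  obtain ⟨x, hx, hx0⟩ := intermediate_value_Icc' hz0.le hcont.continuousOn
    (show (0 : ℝ) ∈ Icc (alternatingPochhammer c z) (alternatingPochhammer c 0) from
      ⟨hz, by simp [h0]⟩)
  have hxm : x ∈ positiveZeros (alternatingPochhammer c) := by
    rw [heq]; exact ⟨hx.1, hx0⟩
  exact ⟨hclosed.isLeast_csInf ⟨x, hxm⟩ hbdd, (csInf_le hbdd hxm).trans (hx.2.trans hzpi)⟩

/-! ### The Turán inequality for the series. -/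

theorem hasDerivAt_rpow_mul_alternatingPochhammer {c : ℝ} (hc : 0 < c) {z : ℝ} (hz : 0 < z) :
    HasDerivAt (fun z => z ^ c * alternatingPochhammer (c + 1) z)
      (c * z ^ (c - 1) * alternatingPochhammer c z) z := by
  refine ((Real.hasDerivAt_rpow_const (Or.inl hz.ne')).mul
    (hasDerivAt_alternatingPochhammer hc hz.ne')).congr_deriv ?_
  rw [Real.rpow_sub_one hz.ne']
  field_simp
  ring

theorem integral_mul_sin_mul_one_sub_rpow {a : ℝ} (ha : 0 < a) (z : ℝ) :
    ∫ u in (0 : ℝ)..1, u * Real.sin (z * u) * (1 - u) ^ (a - 1) =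
      z * alternatingPochhammer (a + 2) z / (a * (a + 1)) -
        z * alternatingPochhammer (a + 3) z / ((a + 1) * (a + 2)) := by
  have ha1 : 0 < a + 1 := by linarith
  have hint : ∀ {b : ℝ}, 0 < b → IntervalIntegrable
      (fun u : ℝ => Real.sin (z * u) * (1 - u) ^ (b - 1)) MeasureTheory.volume 0 1 := fun hb =>
    (intervalIntegrable_one_sub_rpow hb).continuousOn_mul (by fun_prop)
  have h1 := integral_sin_mul_one_sub_rpow ha1 z
  rw [show a + 1 + 2 = a + 3 by ring, show a + 1 + 1 = a + 2 by ring] at h1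
  rw [← integral_sin_mul_one_sub_rpow ha, ← h1, ← integral_sub (hint ha) (hint ha1)]
  refine integral_congr fun u hu => ?_
  rw [uIcc_of_le zero_le_one] at hu
  have : (1 - u) ^ (a + 1 - 1) = (1 - u) ^ (a - 1) * (1 - u) := by
    rcases eq_or_lt_of_le hu.2 with h | h
    · simp [h, ha.ne']
    · rw [show a + 1 - 1 = a - 1 + 1 by ring, Real.rpow_add_one (by linarith)]
  simp only [this]
  ring

theorem integral_mul_sin_mul_one_sub_rpow_pos {a z : ℝ} (ha : 0 < a) (hz : 0 < z)
    (hzpi : z ≤ Real.pi) :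
    0 < ∫ u in (0 : ℝ)..1, u * Real.sin (z * u) * (1 - u) ^ (a - 1) := by
  refine intervalIntegral_pos_of_pos_on
    ((intervalIntegrable_one_sub_rpow ha).continuousOn_mul (by fun_prop)) (fun u hu => ?_) one_pos
  refine mul_pos (mul_pos hu.1 (Real.sin_pos_of_pos_of_lt_pi (mul_pos hz hu.1) ?_))
    (Real.rpow_pos_of_pos (by linarith [hu.2]) _)
  nlinarith [hu.2]

/-- Log-concavity on `(0, π]` of `z ↦ ∫₀ᶻ sin (z - t) tᵃ dt`, in terms of the series. -/
theorem alternatingPochhammer_mul_lt_sq {a z : ℝ} (ha : 0 < a) (hz : 0 < z) (hzpi : z ≤ Real.pi) :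
    (a + 1) * (alternatingPochhammer (a + 1) z * alternatingPochhammer (a + 3) z) <
      (a + 2) * alternatingPochhammer (a + 2) z ^ 2 := by
  have ha1 : 0 < a + 1 := by linarith
  have ha2 : 0 < a + 2 := by linarith
  set G : ℝ → ℝ := fun z => z ^ (a + 2) * alternatingPochhammer (a + 3) z / ((a + 1) * (a + 2))
    with hG
  set K : ℝ → ℝ := fun z => z ^ (a + 1) * alternatingPochhammer (a + 2) z / (a + 1) with hK
  -- Here `K = G'` and `G'' = zᵃ - G`, so `W = G'² - G G''`.
  set W : ℝ → ℝ := fun z => K z ^ 2 + G z ^ 2 - z ^ a * G z with hW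
  have hGc : Continuous G := ((Real.continuous_rpow_const ha2.le).mul
    (continuous_alternatingPochhammer (by linarith))).div_const _
  have hKc : Continuous K := ((Real.continuous_rpow_const ha1.le).mul
    (continuous_alternatingPochhammer (by linarith))).div_const _
  have hWc : Continuous W := by
    have := Real.continuous_rpow_const (q := a) ha.le
    fun_prop
  have hrec : ∀ x : ℝ, 0 < x → x ^ a * alternatingPochhammer (a + 1) x = x ^ a - G x := by
    intro x hx
    rw [hG, alternatingPochhammer_eq_one_sub ha1, show a + 1 + 2 = a + 3 by ring,
      show a + 1 + 1 = a + 2 by ring]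
    simp only [Real.rpow_add hx, Real.rpow_two]
    field_simp
  have hGd : ∀ x : ℝ, 0 < x → HasDerivAt G (K x) x := by
    intro x hx
    have h := (hasDerivAt_rpow_mul_alternatingPochhammer ha2 hx).div_const ((a + 1) * (a + 2))
    rw [show a + 2 + 1 = a + 3 by ring, show a + 2 - 1 = a + 1 by ring] at h
    refine h.congr_deriv ?_
    rw [hK]
    field_simp
  have hKd : ∀ x : ℝ, 0 < x → HasDerivAt K (x ^ a - G x) x := by
    intro x hx
    have h := (hasDerivAt_rpow_mul_alternatingPochhammer ha1 hx).div_const (a + 1)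
    rw [show a + 1 + 1 = a + 2 by ring, show a + 1 - 1 = a by ring] at h
    refine h.congr_deriv ?_
    rw [← hrec x hx]
    field_simp
  have hWd : ∀ x : ℝ, 0 < x → HasDerivAt W (x ^ (a - 1) * (x * K x - a * G x)) x := by
    intro x hx
    refine ((((hKd x hx).pow 2).add ((hGd x hx).pow 2)).sub
      ((Real.hasDerivAt_rpow_const (p := a) (Or.inl hx.ne')).mul (hGd x hx))).congr_deriv ?_
    rw [Real.rpow_sub_one hx.ne']
    field_simp
    ring
  -- Up to the factor `a xᵃ⁺¹`, with `x` kept inside it, this is `∫₀¹ u sin(x u) (1-u)^(a-1) du`.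
  have hpos : ∀ x : ℝ, 0 < x → x ≤ Real.pi → 0 < x * K x - a * G x := by
    intro x hx hxpi
    have h := integral_mul_sin_mul_one_sub_rpow_pos ha hx hxpi
    rw [integral_mul_sin_mul_one_sub_rpow ha] at h
    have h' : x * K x - a * G x = a * x ^ a * x *
        (x * alternatingPochhammer (a + 2) x / (a * (a + 1)) -
        x * alternatingPochhammer (a + 3) x / ((a + 1) * (a + 2))) := by
      simp only [hK, hG, Real.rpow_add hx, Real.rpow_two, Real.rpow_one]
      field_simp
    rw [h']
    have := Real.rpow_pos_of_pos hx a
    positivity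
  have hmono : StrictMonoOn W (Icc 0 Real.pi) := by
    refine strictMonoOn_of_deriv_pos (convex_Icc _ _) hWc.continuousOn fun x hx => ?_
    rw [interior_Icc] at hx
    rw [(hWd x hx.1).deriv]
    exact mul_pos (Real.rpow_pos_of_pos hx.1 _) (hpos x hx.1 hx.2.le)
  have hW0 : W 0 = 0 := by
    simp [hW, hK, hG, Real.zero_rpow ha.ne', Real.zero_rpow ha1.ne', Real.zero_rpow ha2.ne']
  have hWz : 0 < W z := hW0 ▸ hmono ⟨le_rfl, Real.pi_pos.le⟩ ⟨hz.le, hzpi⟩ hz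
  have hWz' : W z = (z ^ a * z) ^ 2 / ((a + 1) ^ 2 * (a + 2)) *
      ((a + 2) * alternatingPochhammer (a + 2) z ^ 2 -
        (a + 1) * (alternatingPochhammer (a + 1) z * alternatingPochhammer (a + 3) z)) := by
    have : W z = K z ^ 2 - (z ^ a * alternatingPochhammer (a + 1) z) * G z := by
      rw [hrec z hz, hW]
      ring
    rw [this, hK, hG]
    simp only [Real.rpow_add hz, Real.rpow_two, Real.rpow_one]
    field_simp
  rw [hWz'] at hWz
  exact sub_pos.1 (pos_of_mul_pos_right hWz (by positivity))

/-! ### Translation to Lommel functions. -/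

theorem lommelPhi_zero_eq (μ : ℝ) : lommelPhi μ 0 = alternatingPochhammer (μ + 2) := by
  ext z
  rw [← hypergeometricOneFTwo_eq_alternatingPochhammer, lommelPhi]
  congr 1 <;> push_cast <;> ring

theorem lommelS_half_eq (μ z : ℝ) : lommelS μ (1 / 2) z =
    z ^ (μ + 1) / ((μ + 1 / 2) * (μ + 3 / 2)) * alternatingPochhammer (μ + 5 / 2) z := by
  rw [← hypergeometricOneFTwo_eq_alternatingPochhammer, lommelS,
    show μ - 1 / 2 + 1 = μ + 1 / 2 by ring, show μ + 1 / 2 + 1 = μ + 3 / 2 by ring,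
    show μ - 1 / 2 + 3 = μ + 5 / 2 by ring, show μ + 1 / 2 + 3 = μ + 5 / 2 + 1 by ring]

theorem positiveZeros_lommelS_half {μ : ℝ} (h1 : μ + 1 / 2 ≠ 0) (h2 : μ + 3 / 2 ≠ 0) :
    positiveZeros (lommelS μ (1 / 2)) = positiveZeros (alternatingPochhammer (μ + 5 / 2)) := by
  ext z
  refine and_congr_right fun hz => ?_
  rw [lommelS_half_eq, mul_eq_zero_iff_left]
  exact div_ne_zero (Real.rpow_pos_of_pos hz (μ + 1)).ne' (mul_ne_zero h1 h2)

/-- The coefficients of `s_μ²` combine to `1 - 1/(1/2 - μ) = (μ + 1/2)/(μ - 1/2)`, which isolates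
the only factor of variable sign. -/
theorem turan_difference_eq {μ z : ℝ} (hz : 0 < z) (hμ : -1 / 2 < μ) (hμ' : μ ≠ 1 / 2) :
    (lommelS μ (1 / 2) z) ^ 2 - lommelS (μ - 1) (1 / 2) z * lommelS (μ + 1) (1 / 2) z -
      1 / (1 / 2 - μ) * (lommelS μ (1 / 2) z) ^ 2 =
    (z ^ μ * z) ^ 2 / ((μ + 1 / 2) * (μ + 3 / 2) ^ 2 * (μ + 5 / 2)) *
      ((μ + 5 / 2) * alternatingPochhammer (μ + 5 / 2) z ^ 2 - (μ + 3 / 2) *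
        (alternatingPochhammer (μ + 3 / 2) z * alternatingPochhammer (μ + 7 / 2) z)) /
      (μ - 1 / 2) := by
  rw [lommelS_half_eq, lommelS_half_eq, lommelS_half_eq, show μ - 1 + 1 = μ by ring,
    show μ - 1 + 1 / 2 = μ - 1 / 2 by ring, show μ - 1 + 3 / 2 = μ + 1 / 2 by ring,
    show μ - 1 + 5 / 2 = μ + 3 / 2 by ring, show μ + 1 + 1 / 2 = μ + 3 / 2 by ring,
    show μ + 1 + 3 / 2 = μ + 5 / 2 by ring, show μ + 1 + 5 / 2 = μ + 7 / 2 by ring,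
    show 1 / 2 - μ = -(μ - 1 / 2) by ring]
  simp only [Real.rpow_add_one hz.ne']
  have h0 : μ - 1 / 2 ≠ 0 := sub_ne_zero.2 hμ'
  have h1 : μ + 1 / 2 ≠ 0 := by linarith
  have h2 : μ + 3 / 2 ≠ 0 := by linarith
  have h3 : μ + 5 / 2 ≠ 0 := by linarith
  generalize alternatingPochhammer (μ + 3 / 2) z = A
  generalize alternatingPochhammer (μ + 5 / 2) z = B
  generalize alternatingPochhammer (μ + 7 / 2) z = C
  generalize z ^ μ = P
  obtain ⟨d, rfl⟩ : ∃ d, μ = d + 1 / 2 := ⟨μ - 1 / 2, by ring⟩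
  rw [add_sub_cancel_right] at *
  rw [show d + 1 / 2 + 1 / 2 = d + 1 by ring, show d + 1 / 2 + 3 / 2 = d + 2 by ring,
    show d + 1 / 2 + 5 / 2 = d + 3 by ring] at *
  field_simp
  ring

theorem turan_factor_pos {μ z : ℝ} (hz : 0 < z) (hzpi : z ≤ Real.pi) (hμ : -1 / 2 < μ) :
    0 < (z ^ μ * z) ^ 2 / ((μ + 1 / 2) * (μ + 3 / 2) ^ 2 * (μ + 5 / 2)) *
      ((μ + 5 / 2) * alternatingPochhammer (μ + 5 / 2) z ^ 2 - (μ + 3 / 2) *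
        (alternatingPochhammer (μ + 3 / 2) z * alternatingPochhammer (μ + 7 / 2) z)) := by
  have h := alternatingPochhammer_mul_lt_sq (a := μ + 1 / 2) (by linarith) hz hzpi
  rw [show μ + 1 / 2 + 1 = μ + 3 / 2 by ring, show μ + 1 / 2 + 2 = μ + 5 / 2 by ring,
    show μ + 1 / 2 + 3 = μ + 7 / 2 by ring] at h
  have h1 : 0 < μ + 1 / 2 := by linarith
  have h2 : 0 < μ + 3 / 2 := by linarith
  have h3 : 0 < μ + 5 / 2 := by linarith
  have h4 := Real.rpow_pos_of_pos hz μ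
  exact mul_pos (by positivity) (sub_pos.2 h)

theorem turanIneqReversed_of_le_pi {μ z : ℝ} (hμ : -1 / 2 < μ) (hμ' : μ < 1 / 2) (hz : 0 < z)
    (hzpi : z ≤ Real.pi) : TuranIneqReversed μ z := by
  refine sub_neg.1 ?_
  rw [turan_difference_eq hz hμ hμ'.ne]
  exact div_neg_of_pos_of_neg (turan_factor_pos hz hzpi hμ) (by linarith)

theorem turanIneq_of_le_pi {μ z : ℝ} (hμ : 1 / 2 < μ) (hz : 0 < z) (hzpi : z ≤ Real.pi) :
    TuranIneq μ z := by
  refine sub_pos.1 ?_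
  rw [turan_difference_eq hz (by linarith) hμ.ne']
  exact div_pos (turan_factor_pos hz hzpi (by linarith)) (by linarith)

theorem isLeast_phiFirstZero {μ : ℝ} (h1 : -3 / 2 < μ) (h2 : μ < 0) :
    IsLeast (positiveZeros (lommelPhi μ 0)) (phiFirstZero μ) ∧ phiFirstZero μ ≤ Real.pi := by
  rw [phiFirstZero, lommelPhi_zero_eq]
  exact isLeast_positiveZeros_alternatingPochhammer (by linarith) (by linarith)

theorem isLeast_lommelFirstZero {μ : ℝ} (h1 : -3 / 2 < μ) (h2 : μ < -1 / 2) :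
    IsLeast (positiveZeros (lommelS μ (1 / 2))) (lommelFirstZero μ) ∧
      lommelFirstZero μ ≤ Real.pi := by
  rw [lommelFirstZero, positiveZeros_lommelS_half (by linarith) (by linarith)]
  exact isLeast_positiveZeros_alternatingPochhammer (by linarith) (by linarith)

theorem mainTheorem2 :
    (∀ μ : ℝ, -1 / 2 < μ → μ < 1 / 2 →
      (IsLeast (positiveZeros (lommelPhi (μ - 1) 0)) (phiFirstZero (μ - 1)) ∧
        ∀ z : ℝ, 0 < z → z < phiFirstZero (μ - 1) → TuranIneqReversed μ z) ∧
      (IsLeast (positiveZeros (lommelS (μ - 1) (1 / 2))) (lommelFirstZero (μ - 1)) ∧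
        ∀ z : ℝ, 0 < z → z < lommelFirstZero (μ - 1) → TuranIneqReversed μ z)) ∧
    (∀ m : ℕ, 2 ≤ m → ∀ μ : ℝ, (m : ℝ) - 3 / 2 < μ → μ < (m : ℝ) - 1 / 2 →
      (IsLeast (positiveZeros (lommelPhi (μ - m) 0)) (phiFirstZero (μ - m)) ∧
        ∀ z : ℝ, 0 < z → z < phiFirstZero (μ - m) → TuranIneq μ z) ∧
      (IsLeast (positiveZeros (lommelS (μ - m) (1 / 2))) (lommelFirstZero (μ - m)) ∧
        ∀ z : ℝ, 0 < z → z < lommelFirstZero (μ - m) → TuranIneq μ z)) := by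
  refine ⟨fun μ h1 h2 => ?_, fun m hm μ h1 h2 => ?_⟩
  · obtain ⟨hφ, hφpi⟩ := isLeast_phiFirstZero (μ := μ - 1) (by linarith) (by linarith)
    obtain ⟨hs, hspi⟩ := isLeast_lommelFirstZero (μ := μ - 1) (by linarith) (by linarith)
    exact ⟨⟨hφ, fun z hz hlt => turanIneqReversed_of_le_pi h1 h2 hz (hlt.le.trans hφpi)⟩,
      ⟨hs, fun z hz hlt => turanIneqReversed_of_le_pi h1 h2 hz (hlt.le.trans hspi)⟩⟩
  · have hm' : (2 : ℝ) ≤ m := by exact_mod_cast hm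
    have hμ : 1 / 2 < μ := by linarith
    obtain ⟨hφ, hφpi⟩ := isLeast_phiFirstZero (μ := μ - m) (by linarith) (by linarith)
    obtain ⟨hs, hspi⟩ := isLeast_lommelFirstZero (μ := μ - m) (by linarith) (by linarith)
    exact ⟨⟨hφ, fun z hz hlt => turanIneq_of_le_pi hμ hz (hlt.le.trans hφpi)⟩,
      ⟨hs, fun z hz hlt => turanIneq_of_le_pi hμ hz (hlt.le.trans hspi)⟩⟩
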